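/- Let $N\ge 3$ and $2^*=\frac{2N}{N-2}$. Let $f:\mathbb{R}^N\times\mathbb{R}\to\mathbb{R}$ satisfy $$|f(x,s)|\le C_0\left(|s|^{p-1}+|s|^{2^*-1}\right)\qquad\text{for all } x\in\mathbb{R}^N,\ s\in\mathbb{R},$$ for some $p\in[2,2^*]$ and some $C_0>0$. Let $\mathcal{D}^{1,2}(\mathbb{R}^N)$ be the completion of $C_c^\infty(\mathbb{R}^N)$ with respect to the norm $\|\varphi\|=\|\nabla\varphi\|_{L^2(\mathbb{R}^N)}$, realised through the Sobolev inequality as a space of functions in $L^{2^*}(\mathbb{R}^N)$ having a weak gradient in $L^2(\mathbb{R}^N)$. Let $u\in\mathcal{D}^{1,2}(\mathbb{R}^N)\cap L^p(\mathbb{R}^N)$ be a real-valued weak solution of $$-\Delta u=f(x,u)\qquad\text{in }\mathbb{R}^N,$$ that is, $x\mapsto f(x,u(x))$ is locally integrable on $\mathbb{R}^N$ and $$\int_{\mathbb{R}^N}\nabla u\cdot\nabla\varphi\,dx=\int_{\mathbb{R}^N}f(x,u)\,\varphi\,dx\qquad\text{for all }\varphi\in C_c^\infty(\mathbb{R}^N).$$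 Then $u\in L^\infty(\mathbb{R}^N)$. -/

import Mathlib

open MeasureTheory Filter Topology
open scoped ContDiff

/-- The critical Sobolev exponent `2^* = 2N/(N-2)`; used for `N ≥ 3` only. -/
noncomputable def sobolevStar (N : ℕ) : ℝ := 2 * (N : ℝ) / ((N : ℝ) - 2)

/-- Test functions: real functions of class `C^∞` with compact support on `ℝ^N`. -/
def IsTestFunction {N : ℕ} (φ : EuclideanSpace ℝ (Fin N) → ℝ) : Prop :=
  ContDiff ℝ ∞ φ ∧ HasCompactSupport φ

/-- `G` is the weak (distributional) gradient of `u` on `ℝ^N`. -/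
def HasWeakGradient {N : ℕ} (u : EuclideanSpace ℝ (Fin N) → ℝ)
    (G : EuclideanSpace ℝ (Fin N) → EuclideanSpace ℝ (Fin N)) : Prop :=
  LocallyIntegrable u volume ∧ LocallyIntegrable G volume ∧
    ∀ φ : EuclideanSpace ℝ (Fin N) → ℝ, IsTestFunction φ →
      ∫ x, u x • gradient φ x = - ∫ x, φ x • G x

/-- `u` belongs to `D^{1,2}(ℝ^N)`, the completion of the test functions for the norm
`‖∇φ‖_{L²}`. By the Sobolev inequality a Cauchy sequence for that norm converges in `L^{2^*}`, and
the completion is realised, as usual, as the space of the limits, up to equality almost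
everywhere. -/
def MemD12 {N : ℕ} (u : EuclideanSpace ℝ (Fin N) → ℝ) : Prop :=
  MemLp u (ENNReal.ofReal (sobolevStar N)) volume ∧
    ∃ G : EuclideanSpace ℝ (Fin N) → EuclideanSpace ℝ (Fin N),
      HasWeakGradient u G ∧ MemLp G 2 volume ∧
        ∃ φ : ℕ → EuclideanSpace ℝ (Fin N) → ℝ,
          (∀ n, IsTestFunction (φ n)) ∧
          Tendsto (fun n => eLpNorm (fun x => gradient (φ n) x - G x) 2 volume) atTop (𝓝 0) ∧
          Tendsto (fun n => eLpNorm (fun x => φ n x - u x)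
            (ENNReal.ofReal (sobolevStar N)) volume) atTop (𝓝 0)

/-- `u` is a weak solution of `-Δu = f(x,u)` in `ℝ^N`: `f(·,u)` is locally integrable (in
particular measurable), and `∫ ∇u · ∇φ = ∫ f(x,u) φ` for every test function `φ`. -/
def IsWeakSolution {N : ℕ} (f : EuclideanSpace ℝ (Fin N) → ℝ → ℝ)
    (u : EuclideanSpace ℝ (Fin N) → ℝ) : Prop :=
  LocallyIntegrable (fun x => f x (u x)) volume ∧
    ∃ G : EuclideanSpace ℝ (Fin N) → EuclideanSpace ℝ (Fin N),
      HasWeakGradient u G ∧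
        ∀ φ : EuclideanSpace ℝ (Fin N) → ℝ, IsTestFunction φ →
          ∫ x, inner ℝ (G x) (gradient φ x) = ∫ x, f x (u x) * φ x

/-! The proof is a De Giorgi iteration at critical growth. Write q = 2^*. Since 1 ≤ p - 1 ≤ q - 1,
the growth condition gives |f(x,u)| ≤ 2C₀(1 + |u|^(q-1)). Testing the equation with a smooth ramp
Ψ(u) vanishing below b ≥ 1 and applying Sobolev yields ‖Ψ(u)‖_q² ≤ S² ∫ |f(x,u)| Ψ(u)
(`eLpNorm_comp_ramp_sq_le`).

For 0 ≤ h < b < k, one has u ≤ b/(b-h) · (u-h) on {u > b}. So g(k) = ‖(u-k)⁺‖_q satisfies g(k)² ≤ A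
(b/(b-h))^(q-1) g(h)^q. The power q > 2 makes the iteration superlinear, but it needs a small start.
The factor depends only on the ratio b/(b-h), so along levels k₀(2 - 2⁻ⁿ) the required smallness
does not depend on k₀. As g(k₀) → 0 when k₀ → ∞, a large k₀ is admissible, and g(2k₀) = 0
(`exists_ae_le_of_level_estimate`). Applying this to u and to -u bounds |u|. -/

/-! ### Smooth truncations. -/

/-- A smooth approximation of a truncation `t ↦ (t - a)⁺`: nondecreasing, `1`-Lipschitz, and
vanishing on `(-∞, a]`. -/
structure IsSmoothRamp (a : ℝ) (Ψ : ℝ → ℝ) : Prop where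
  contDiff : ContDiff ℝ ∞ Ψ
  deriv_nonneg : ∀ t, 0 ≤ deriv Ψ t
  deriv_le_one : ∀ t, deriv Ψ t ≤ 1
  eq_zero : ∀ t ≤ a, Ψ t = 0

namespace IsSmoothRamp

variable {a : ℝ} {Ψ : ℝ → ℝ}

lemma differentiable (h : IsSmoothRamp a Ψ) : Differentiable ℝ Ψ :=
  h.contDiff.differentiable (by simp)

lemma nonneg (h : IsSmoothRamp a Ψ) (t : ℝ) : 0 ≤ Ψ t := by
  rcases le_total t a with hta | hta
  · rw [h.eq_zero t hta]
  · rw [← h.eq_zero a le_rfl]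
    exact monotone_of_deriv_nonneg h.differentiable h.deriv_nonneg hta

lemma abs_sub_le (h : IsSmoothRamp a Ψ) (s t : ℝ) : |Ψ s - Ψ t| ≤ |s - t| := by
  have := Convex.norm_image_sub_le_of_norm_deriv_le (f := Ψ) (C := 1) (s := Set.univ) (x := t)
    (y := s) (fun x _ => h.differentiable x)
    (fun x _ => by
      rw [Real.norm_eq_abs, abs_of_nonneg (h.deriv_nonneg x)]; exact h.deriv_le_one x)
    convex_univ trivial trivial
  simpa using this

lemma le_posPart (h : IsSmoothRamp a Ψ) (t : ℝ) : Ψ t ≤ max (t - a) 0 := by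
  rcases le_total t a with hta | hta
  · rw [h.eq_zero t hta]; exact le_max_right _ _
  · have := h.abs_sub_le t a
    rw [h.eq_zero a le_rfl, sub_zero, abs_of_nonneg (h.nonneg t), abs_of_nonneg (by linarith)]
      at this
    exact this.trans (le_max_left _ _)

end IsSmoothRamp

/-- The ramp is the primitive of a smooth step rising from 0 at `a` to 1 at `b`. Its slope is 1
beyond `b`, so it stays above `t - b`. -/
lemma exists_isSmoothRamp {a b : ℝ} (hab : a < b) :
    ∃ Ψ, IsSmoothRamp a Ψ ∧ ∀ t, t - b ≤ Ψ t := by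
  set w : ℝ → ℝ := fun s => Real.smoothTransition ((s - a) / (b - a)) with hw
  have hwc : ContDiff ℝ ∞ w :=
    Real.smoothTransition.contDiff.comp ((contDiff_id.sub contDiff_const).div_const _)
  have hd : ∀ t, HasDerivAt (fun t => ∫ s in a..t, w s) (w t) t := fun t =>
    (hwc.continuous.integral_hasStrictDerivAt a t).hasDerivAt
  have hder : deriv (fun t => ∫ s in a..t, w s) = w := funext fun t => (hd t).deriv
  have h01 : ∀ t, 0 ≤ w t ∧ w t ≤ 1 := fun t =>
    ⟨Real.smoothTransition.nonneg _, Real.smoothTransition.le_one _⟩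
  have hR : IsSmoothRamp a (fun t => ∫ s in a..t, w s) := by
    refine ⟨?_, fun t => ?_, fun t => ?_, fun t ht => ?_⟩
    · rw [contDiff_infty_iff_deriv, hder]
      exact ⟨fun t => (hd t).differentiableAt, hwc⟩
    · rw [hder]; exact (h01 t).1
    · rw [hder]; exact (h01 t).2
    · rw [intervalIntegral.integral_congr (g := fun _ => (0 : ℝ)), intervalIntegral.integral_zero]
      intro s hs
      rw [Set.uIcc_of_ge ht] at hs
      exact Real.smoothTransition.zero_of_nonpos
        (div_nonpos_of_nonpos_of_nonneg (by linarith [hs.2]) (by linarith))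
  refine ⟨_, hR, fun t => ?_⟩
  rcases le_total t b with htb | htb
  · linarith [hR.nonneg t]
  · have h1 : ∫ s in b..t, w s = t - b := by
      rw [intervalIntegral.integral_congr (g := fun _ => (1 : ℝ))]
      · simp
      intro s hs
      rw [Set.uIcc_of_le htb] at hs
      refine Real.smoothTransition.one_of_one_le ?_
      rw [le_div_iff₀ (by linarith)]; linarith [hs.1]
    have h2 := intervalIntegral.integral_add_adjacent_intervals
      (hwc.continuous.intervalIntegrable (μ := volume) a b)
      (hwc.continuous.intervalIntegrable (μ := volume) b t)
    have h3 := hR.nonneg b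
    change t - b ≤ ∫ s in a..t, w s
    linarith

/-! ### Sobolev and energy inequalities for truncated test functions. -/

section TestFunctions

variable {N : ℕ} {φ : EuclideanSpace ℝ (Fin N) → ℝ} {a : ℝ} {Ψ : ℝ → ℝ}

lemma IsTestFunction.differentiable (hφ : IsTestFunction φ) : Differentiable ℝ φ :=
  hφ.1.differentiable (by simp)

lemma IsTestFunction.continuous_gradient (hφ : IsTestFunction φ) : Continuous (gradient φ) :=
  (InnerProductSpace.toDual ℝ _).symm.continuous.comp (hφ.1.continuous_fderiv (by simp))

lemma IsTestFunction.hasCompactSupport_gradient (hφ : IsTestFunction φ) :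
    HasCompactSupport (gradient φ) :=
  hφ.2.fderiv ℝ |>.comp_left (g := (InnerProductSpace.toDual ℝ _).symm) (map_zero _)

lemma IsTestFunction.comp_ramp (hφ : IsTestFunction φ) (hΨ : IsSmoothRamp a Ψ) (ha : 0 ≤ a) :
    IsTestFunction (fun x => Ψ (φ x)) :=
  ⟨hΨ.contDiff.comp hφ.1, hφ.2.comp_left (hΨ.eq_zero 0 ha)⟩

lemma IsTestFunction.gradient_comp_ramp (hφ : IsTestFunction φ) (hΨ : IsSmoothRamp a Ψ)
    (x : EuclideanSpace ℝ (Fin N)) :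
    gradient (fun x => Ψ (φ x)) x = deriv Ψ (φ x) • gradient φ x := by
  have h := (hΨ.differentiable (φ x)).hasDerivAt.comp_hasFDerivAt x
    (hφ.differentiable x).hasFDerivAt
  rw [gradient, gradient, ← map_smul]
  congr 1
  exact h.fderiv

/-- Sobolev's inequality for test functions. -/
lemma exists_sobolev_const (hN : 3 ≤ N) :
    ∃ S : NNReal, ∀ φ : EuclideanSpace ℝ (Fin N) → ℝ, IsTestFunction φ →
      eLpNorm φ (ENNReal.ofReal (sobolevStar N)) volume ≤ S * eLpNorm (gradient φ) 2 volume := by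
  refine ⟨SNormLESNormFDerivOfEqConst ℝ (volume : Measure (EuclideanSpace ℝ (Fin N))) 2,
    fun φ hφ => ?_⟩
  have hN' : (3 : ℝ) ≤ N := by exact_mod_cast hN
  have h := eLpNorm_le_eLpNorm_fderiv_of_eq (F := ℝ)
    (volume : Measure (EuclideanSpace ℝ (Fin N))) (hφ.1.of_le (by simp)) hφ.2
    (p := 2) (p' := (sobolevStar N).toNNReal) (by norm_num) (by simp; omega) (by
      rw [Real.coe_toNNReal _ (by unfold sobolevStar; apply div_nonneg <;> linarith)]
      simp only [finrank_euclideanSpace, Fintype.card_fin, sobolevStar]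
      have : (N : ℝ) - 2 ≠ 0 := by linarith
      push_cast
      field_simp)
  refine h.trans (le_of_eq ?_)
  congr 1
  refine eLpNorm_congr_norm_ae (ae_of_all _ fun x => ?_)
  simp [gradient]

lemma eLpNorm_inner_le {f g : EuclideanSpace ℝ (Fin N) → EuclideanSpace ℝ (Fin N)}
    (hf : AEStronglyMeasurable f volume) (hg : AEStronglyMeasurable g volume) :
    eLpNorm (fun x => (inner ℝ (f x) (g x) : ℝ)) 1 volume ≤
      eLpNorm f 2 volume * eLpNorm g 2 volume := by
  have h := eLpNorm_le_eLpNorm_mul_eLpNorm_of_nnnorm (r := 1) (p := 2) (q := 2)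
    hf hg (fun x y => (inner ℝ x y : ℝ)) 1
    (ae_of_all _ fun x => by rw [one_mul]; exact nnnorm_inner_le_nnnorm _ _)
  simpa using h

lemma integrable_inner_of_memLp_two {f g : EuclideanSpace ℝ (Fin N) → EuclideanSpace ℝ (Fin N)}
    (hf : MemLp f 2 volume) (hg : MemLp g 2 volume) :
    Integrable (fun x => (inner ℝ (f x) (g x) : ℝ)) volume :=
  memLp_one_iff_integrable.1 ⟨hf.1.inner hg.1,
    (eLpNorm_inner_le hf.1 hg.1).trans_lt (ENNReal.mul_lt_top hf.2 hg.2)⟩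

/-- The energy of a truncated test function, tested against a weak equation `-div G = F`. -/
lemma lintegral_enorm_gradient_comp_sq_le {F : EuclideanSpace ℝ (Fin N) → ℝ}
    {G : EuclideanSpace ℝ (Fin N) → EuclideanSpace ℝ (Fin N)} (hG : MemLp G 2 volume)
    (hw : ∀ φ : EuclideanSpace ℝ (Fin N) → ℝ, IsTestFunction φ →
      ∫ x, inner ℝ (G x) (gradient φ x) = ∫ x, F x * φ x)
    (hφ : IsTestFunction φ) (hΨ : IsSmoothRamp a Ψ) (ha : 0 ≤ a) :
    eLpNorm (gradient (fun x => Ψ (φ x))) 2 volume ^ 2 ≤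
      (∫⁻ x, ‖F x‖ₑ * ‖Ψ (φ x)‖ₑ) +
        eLpNorm (fun x => gradient φ x - G x) 2 volume * eLpNorm (gradient φ) 2 volume := by
  set v : EuclideanSpace ℝ (Fin N) → ℝ := fun x => Ψ (φ x) with hv
  have hvt : IsTestFunction v := hφ.comp_ramp hΨ ha
  have hgr : ∀ x, gradient v x = deriv Ψ (φ x) • gradient φ x := hφ.gradient_comp_ramp hΨ
  have hv2 : MemLp (gradient v) 2 volume :=
    hvt.continuous_gradient.memLp_of_hasCompactSupport hvt.hasCompactSupport_gradient
  have hφ2 : MemLp (gradient φ) 2 volume :=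
    hφ.continuous_gradient.memLp_of_hasCompactSupport hφ.hasCompactSupport_gradient
  have hle : ∀ x, ‖gradient v x‖ ≤ ‖gradient φ x‖ := fun x => by
    rw [hgr, norm_smul, Real.norm_eq_abs, abs_of_nonneg (hΨ.deriv_nonneg _)]
    exact mul_le_of_le_one_left (norm_nonneg _) (hΨ.deriv_le_one _)
  have hI1 : Integrable (fun x => (inner ℝ (gradient φ x - G x) (gradient v x) : ℝ)) volume :=
    integrable_inner_of_memLp_two (hφ2.sub hG) hv2
  have hI2 : Integrable (fun x => (inner ℝ (G x) (gradient v x) : ℝ)) volume :=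
    integrable_inner_of_memLp_two hG hv2
  -- As 0 ≤ Ψ' ≤ 1, |∇v|² = Ψ'²|∇φ|² ≤ Ψ'|∇φ|² = ∇φ · ∇v. Splitting ∇φ = (∇φ - G) + G isolates the
  -- part to which the equation applies.
  have hmono : ∫ x, ‖gradient v x‖ ^ 2 ≤
      ∫ x, inner ℝ (gradient φ x - G x) (gradient v x) + inner ℝ (G x) (gradient v x) := by
    refine integral_mono (hv2.integrable_norm_pow (by norm_num)) (hI1.add hI2) fun x => ?_
    simp only
    rw [← inner_add_left, sub_add_cancel, hgr, norm_smul, inner_smul_right,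
      real_inner_self_eq_norm_sq, mul_pow, Real.norm_eq_abs, sq_abs]
    have h0 := hΨ.deriv_nonneg (φ x)
    have h1 := hΨ.deriv_le_one (φ x)
    nlinarith [mul_nonneg (mul_nonneg h0 (sub_nonneg.2 h1)) (sq_nonneg ‖gradient φ x‖)]
  rw [integral_add hI1 hI2, hw v hvt] at hmono
  have hL : eLpNorm (gradient v) 2 volume ^ 2 = ENNReal.ofReal (∫ x, ‖gradient v x‖ ^ 2) := by
    rw [ofReal_integral_eq_lintegral_ofReal (hv2.integrable_norm_pow (by norm_num))
      (ae_of_all _ fun x => by positivity), ← ENNReal.rpow_two]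
    have h2 := eLpNorm_nnreal_pow_eq_lintegral (μ := volume) (f := gradient v) (p := 2) (by simp)
    simp only [ENNReal.coe_ofNat, NNReal.coe_ofNat] at h2
    rw [h2]
    refine lintegral_congr fun x => ?_
    rw [ENNReal.ofReal_pow (norm_nonneg _), ofReal_norm, ENNReal.rpow_two]
  have hA : ENNReal.ofReal (∫ x, F x * v x) ≤ ∫⁻ x, ‖F x‖ₑ * ‖Ψ (φ x)‖ₑ := by
    refine (ENNReal.ofReal_le_ofReal (le_abs_self _)).trans ?_
    rw [← Real.norm_eq_abs, ofReal_norm]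
    refine (enorm_integral_le_lintegral_enorm _).trans (le_of_eq ?_)
    simp [enorm_mul, hv]
  have hB : ENNReal.ofReal (∫ x, inner ℝ (gradient φ x - G x) (gradient v x)) ≤
      eLpNorm (fun x => gradient φ x - G x) 2 volume * eLpNorm (gradient φ) 2 volume := by
    refine (ENNReal.ofReal_le_ofReal (le_abs_self _)).trans ?_
    rw [← Real.norm_eq_abs, ofReal_norm]
    refine (enorm_integral_le_lintegral_enorm _).trans ?_
    rw [← eLpNorm_one_eq_lintegral_enorm]
    refine (eLpNorm_inner_le (hφ2.sub hG).1 hv2.1).trans ?_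
    gcongr
    · exact le_rfl
    · exact eLpNorm_mono hle
  rw [hL]
  refine (ENNReal.ofReal_le_ofReal hmono).trans (ENNReal.ofReal_add_le.trans ?_)
  rw [add_comm]
  exact add_le_add hA hB

end TestFunctions

/-! ### Passage from test functions to the solution. -/

section Limit

lemma eLpNorm_ofReal_rpow {α E : Type*} [MeasurableSpace α] {μ : Measure α}
    [NormedAddCommGroup E] (f : α → E) {q : ℝ} (hq : 0 < q) :
    eLpNorm f (ENNReal.ofReal q) μ ^ q = ∫⁻ x, ‖f x‖ₑ ^ q ∂μ := by
  have h := eLpNorm_nnreal_pow_eq_lintegral (μ := μ) (f := f) (p := q.toNNReal)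
    (by simpa using hq)
  rwa [Real.coe_toNNReal _ hq.le] at h

lemma lintegral_enorm_mul_rpow_le {α : Type*} [MeasurableSpace α] {μ : Measure α}
    {f g : α → ℝ} {q : ℝ} (hq : 1 < q) (hf : AEStronglyMeasurable f μ)
    (hg : AEStronglyMeasurable g μ) :
    ∫⁻ x, ‖f x‖ₑ * ‖g x‖ₑ ^ (q - 1) ∂μ ≤
      eLpNorm f (ENNReal.ofReal q) μ * eLpNorm g (ENNReal.ofReal q) μ ^ (q - 1) := by
  have hq0 : 0 < q := by linarith
  have hc := Real.HolderConjugate.conjExponent hq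
  refine (ENNReal.lintegral_mul_rpow_le_lintegral_rpow_mul_lintegral_rpow hc
    hf.enorm hg.enorm).trans (le_of_eq ?_)
  rw [← eLpNorm_ofReal_rpow f hq0, ← eLpNorm_ofReal_rpow g hq0, ← ENNReal.rpow_mul,
    ← ENNReal.rpow_mul, mul_one_div_cancel hq0.ne', ENNReal.rpow_one]
  congr 2
  rw [Real.conjExponent]
  have : q - 1 ≠ 0 := by linarith
  field_simp

/-- Pointwise control of the error made in the nonlinear term: truncations above level `1` only
see points at which one of the arguments exceeds `1`. -/
lemma enorm_mul_enorm_sub_le {a C q F s t : ℝ} {Ψ : ℝ → ℝ} (hΨ : IsSmoothRamp a Ψ) (ha : 1 ≤ a)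
    (hq : 1 ≤ q) (hC : 0 ≤ C) (hF : |F| ≤ C * (1 + |t| ^ (q - 1))) :
    ‖F‖ₑ * ‖Ψ s - Ψ t‖ₑ ≤ ENNReal.ofReal (2 * C) *
      (‖s - t‖ₑ * ‖s‖ₑ ^ (q - 1) + ‖s - t‖ₑ * ‖t‖ₑ ^ (q - 1)) := by
  have hq' : 0 ≤ q - 1 := by linarith
  have key : |F| * |Ψ s - Ψ t| ≤
      2 * C * (|s - t| * |s| ^ (q - 1) + |s - t| * |t| ^ (q - 1)) := by
    have hs0 : 0 ≤ |s| ^ (q - 1) := by positivity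
    have ht0 : 0 ≤ |t| ^ (q - 1) := by positivity
    by_cases hst : s ≤ a ∧ t ≤ a
    · rw [hΨ.eq_zero s hst.1, hΨ.eq_zero t hst.2, sub_self, abs_zero, mul_zero]
      positivity
    -- This is where `1 ≤ a` enters: the constant 1 in the bound on F, not integrable over the whole
    -- space, is absorbed by the powers.
    · have h1 : 1 ≤ |s| ^ (q - 1) + |t| ^ (q - 1) := by
        by_cases hs : s ≤ a
        · have : t > a := by
            by_contra h; exact hst ⟨hs, not_lt.1 h⟩
          have := Real.one_le_rpow (x := |t|) ((ha.trans this.le).trans (le_abs_self t)) hq'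
          linarith
        · have := Real.one_le_rpow (x := |s|)
            ((ha.trans (not_le.1 hs).le).trans (le_abs_self s)) hq'
          linarith
      have h2 : |F| ≤ 2 * C * (|s| ^ (q - 1) + |t| ^ (q - 1)) := by
        refine hF.trans ?_
        rw [mul_comm 2 C, mul_assoc]
        exact mul_le_mul_of_nonneg_left (by linarith) hC
      calc |F| * |Ψ s - Ψ t| ≤ (2 * C * (|s| ^ (q - 1) + |t| ^ (q - 1))) * |s - t| :=
            mul_le_mul h2 (hΨ.abs_sub_le s t) (abs_nonneg _) (by positivity)
        _ = _ := by ring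
  have h := ENNReal.ofReal_le_ofReal key
  rw [ENNReal.ofReal_mul (abs_nonneg _), ENNReal.ofReal_mul (by positivity),
    ENNReal.ofReal_add (by positivity) (by positivity), ENNReal.ofReal_mul (abs_nonneg _),
    ENNReal.ofReal_mul (abs_nonneg _), ← ENNReal.ofReal_rpow_of_nonneg (abs_nonneg _) hq',
    ← ENNReal.ofReal_rpow_of_nonneg (abs_nonneg _) hq'] at h
  simpa only [← Real.enorm_eq_ofReal_abs] using h

variable {N : ℕ}

/-- Truncating the approximants φₙ instead of u keeps every test function smooth, so no chain rule
for weak gradients is needed. The errors are controlled by `e n` and `d n`, which tend to 0. -/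
lemma eLpNorm_comp_ramp_sq_le {S : NNReal} {q C a : ℝ}
    (hS : ∀ φ : EuclideanSpace ℝ (Fin N) → ℝ, IsTestFunction φ →
      eLpNorm φ (ENNReal.ofReal q) volume ≤ S * eLpNorm (gradient φ) 2 volume)
    (hq : 1 < q) (hC : 0 ≤ C)
    {u F : EuclideanSpace ℝ (Fin N) → ℝ}
    {G : EuclideanSpace ℝ (Fin N) → EuclideanSpace ℝ (Fin N)}
    {φ : ℕ → EuclideanSpace ℝ (Fin N) → ℝ}
    (hu : MemLp u (ENNReal.ofReal q) volume) (hG : MemLp G 2 volume)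
    (hφ : ∀ n, IsTestFunction (φ n))
    (hφG : Tendsto (fun n => eLpNorm (fun x => gradient (φ n) x - G x) 2 volume) atTop (𝓝 0))
    (hφu : Tendsto (fun n => eLpNorm (fun x => φ n x - u x) (ENNReal.ofReal q) volume)
      atTop (𝓝 0))
    (hw : ∀ φ : EuclideanSpace ℝ (Fin N) → ℝ, IsTestFunction φ →
      ∫ x, inner ℝ (G x) (gradient φ x) = ∫ x, F x * φ x)
    (hFm : AEStronglyMeasurable F volume)
    (hF : ∀ x, |F x| ≤ C * (1 + |u x| ^ (q - 1)))
    {Ψ : ℝ → ℝ} (hΨ : IsSmoothRamp a Ψ) (ha : 1 ≤ a) :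
    eLpNorm (fun x => Ψ (u x)) (ENNReal.ofReal q) volume ^ 2 ≤
      (S : ENNReal) ^ 2 * ∫⁻ x, ‖F x‖ₑ * ‖Ψ (u x)‖ₑ := by
  set Q := ENNReal.ofReal q with hQ
  have hQ1 : 1 ≤ Q := by rw [hQ, ← ENNReal.ofReal_one]; exact ENNReal.ofReal_le_ofReal hq.le
  have hq' : 0 ≤ q - 1 := by linarith
  set e : ℕ → ENNReal := fun n => eLpNorm (fun x => φ n x - u x) Q volume with he
  set d : ℕ → ENNReal := fun n => eLpNorm (fun x => gradient (φ n) x - G x) 2 volume with hd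
  set U := eLpNorm u Q volume with hU
  set W := eLpNorm G 2 volume with hW
  set I := ∫⁻ x, ‖F x‖ₑ * ‖Ψ (u x)‖ₑ with hI
  have hφm : ∀ n, AEStronglyMeasurable (φ n) volume := fun n =>
    (hφ n).1.continuous.aestronglyMeasurable
  have hΨm : ∀ {w : EuclideanSpace ℝ (Fin N) → ℝ}, AEStronglyMeasurable w volume →
      AEStronglyMeasurable (fun x => Ψ (w x)) volume := fun hw =>
    hΨ.contDiff.continuous.comp_aestronglyMeasurable hw
  have hφU : ∀ n, eLpNorm (φ n) Q volume ≤ U + e n := fun n => by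
    have := eLpNorm_add_le (μ := volume) hu.1 ((hφm n).sub hu.1) hQ1
    rwa [add_sub_cancel] at this
  have hφW : ∀ n, eLpNorm (gradient (φ n)) 2 volume ≤ W + d n := fun n => by
    have := eLpNorm_add_le (μ := volume) (p := 2) hG.1
      ((hφ n).continuous_gradient.aestronglyMeasurable.sub hG.1) (by norm_num)
    rwa [add_sub_cancel] at this
  have hlow : ∀ n, eLpNorm (fun x => Ψ (u x)) Q volume ≤
      eLpNorm (fun x => Ψ (φ n x)) Q volume + e n := fun n => by
    have h := eLpNorm_sub_le (μ := volume) (hΨm (hφm n)) ((hΨm (hφm n)).sub (hΨm hu.1)) hQ1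
    rw [sub_sub_cancel] at h
    refine h.trans (add_le_add le_rfl (eLpNorm_mono fun x => ?_))
    simpa using hΨ.abs_sub_le (φ n x) (u x)
  have herr : ∀ n, ∫⁻ x, ‖F x‖ₑ * ‖Ψ (φ n x) - Ψ (u x)‖ₑ ≤
      ENNReal.ofReal (2 * C) * (e n * (U + e n) ^ (q - 1) + e n * U ^ (q - 1)) := fun n => by
    refine (lintegral_mono fun x =>
      enorm_mul_enorm_sub_le (q := q) (s := φ n x) hΨ ha hq.le hC (hF x)).trans ?_
    have hm := (hφm n).sub hu.1
    rw [lintegral_const_mul' _ _ ENNReal.ofReal_ne_top, lintegral_add_left']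
    · gcongr
      · refine (lintegral_enorm_mul_rpow_le hq hm (hφm n)).trans ?_
        gcongr
        · exact le_rfl
        · exact hφU n
      · exact lintegral_enorm_mul_rpow_le hq hm hu.1
    · exact hm.enorm.mul ((hφm n).enorm.pow_const _)
  have hFv : ∀ n, ∫⁻ x, ‖F x‖ₑ * ‖Ψ (φ n x)‖ₑ ≤
      I + ENNReal.ofReal (2 * C) * (e n * (U + e n) ^ (q - 1) + e n * U ^ (q - 1)) := fun n => by
    refine le_trans ?_ (add_le_add le_rfl (herr n))
    rw [hI, ← lintegral_add_left' (f := fun x => ‖F x‖ₑ * ‖Ψ (u x)‖ₑ)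
      (hFm.enorm.mul (hΨm hu.1).enorm)]
    refine lintegral_mono fun x => ?_
    rw [← mul_add]
    gcongr
    calc ‖Ψ (φ n x)‖ₑ = ‖Ψ (u x) + (Ψ (φ n x) - Ψ (u x))‖ₑ := by rw [add_sub_cancel]
      _ ≤ _ := enorm_add_le _ _
  set R : ℕ → ENNReal := fun n => (S : ENNReal) ^ 2 *
    (I + ENNReal.ofReal (2 * C) * (e n * (U + e n) ^ (q - 1) + e n * U ^ (q - 1)) +
      d n * (W + d n)) with hR
  -- Truncated subtraction in `ENNReal` avoids having to know beforehand that the norm of Ψ(u) is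
  -- finite.
  have hmain : ∀ n, (eLpNorm (fun x => Ψ (u x)) Q volume - e n) ^ 2 ≤ R n := fun n => by
    have h1 : eLpNorm (fun x => Ψ (u x)) Q volume - e n ≤
        S * eLpNorm (gradient fun x => Ψ (φ n x)) 2 volume :=
      (tsub_le_iff_right.2 (hlow n)).trans
        (hS _ ((hφ n).comp_ramp hΨ (zero_le_one.trans ha)))
    refine (pow_le_pow_left' h1 2).trans ?_
    rw [mul_pow]
    refine mul_le_mul_right ?_ _
    refine (lintegral_enorm_gradient_comp_sq_le hG hw (hφ n) hΨ (zero_le_one.trans ha)).trans ?_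
    exact add_le_add (hFv n) (mul_le_mul_right (hφW n) _)
  have hUtop : U ≠ ⊤ := hu.2.ne
  have hWtop : W ≠ ⊤ := hG.2.ne
  have hleft : Tendsto (fun n => (eLpNorm (fun x => Ψ (u x)) Q volume - e n) ^ 2) atTop
      (𝓝 ((eLpNorm (fun x => Ψ (u x)) Q volume) ^ 2)) := by
    have h := ENNReal.Tendsto.sub (tendsto_const_nhds
      (x := eLpNorm (fun x => Ψ (u x)) Q volume) (f := atTop (α := ℕ))) hφu (Or.inr (by simp))
    rw [tsub_zero] at h
    exact ((ENNReal.continuous_pow 2).tendsto _).comp h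
  have hUe : Tendsto (fun n => (U + e n) ^ (q - 1)) atTop (𝓝 (U ^ (q - 1))) := by
    have h := (tendsto_const_nhds (x := U) (f := atTop (α := ℕ))).add hφu
    rw [add_zero] at h
    exact h.ennrpow_const _
  have hUq : U ^ (q - 1) ≠ ⊤ := ENNReal.rpow_ne_top_of_nonneg hq' hUtop
  have hright : Tendsto R atTop (𝓝 ((S : ENNReal) ^ 2 * I)) := by
    have h1 : Tendsto (fun n => e n * (U + e n) ^ (q - 1)) atTop (𝓝 (0 * U ^ (q - 1))) :=
      ENNReal.Tendsto.mul hφu (Or.inr hUq) hUe (Or.inr (by simp))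
    have h2 : Tendsto (fun n => e n * U ^ (q - 1)) atTop (𝓝 (0 * U ^ (q - 1))) :=
      ENNReal.Tendsto.mul_const hφu (Or.inr hUq)
    have h3 : Tendsto (fun n => d n * (W + d n)) atTop (𝓝 (0 * (W + 0))) :=
      ENNReal.Tendsto.mul hφG (Or.inr (by simpa using hWtop))
        (tendsto_const_nhds.add hφG) (Or.inr (by simp))
    have h4 := ENNReal.Tendsto.const_mul (h1.add h2) (Or.inr (ENNReal.ofReal_ne_top (r := 2 * C)))
    have h5 := ENNReal.Tendsto.const_mul
      (((tendsto_const_nhds (x := I) (f := atTop (α := ℕ))).add h4).add h3)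
      (Or.inr (show (S : ENNReal) ^ 2 ≠ ⊤ by simp))
    simpa only [zero_mul, mul_zero, add_zero] using h5
  exact le_of_tendsto_of_tendsto' hleft hright hmain

end Limit

/-! ### De Giorgi iteration on superlevel sets. -/

section Iteration

/-- Fast geometric convergence. -/
lemma exists_smallness_of_superlinear {A B q : ℝ} (hA : 0 < A) (hB : 0 < B) (hq : 2 < q) :
    ∃ ε > 0, ∀ Y : ℕ → ℝ, (∀ n, 0 ≤ Y n) → Y 0 ≤ ε →
      (∀ n, Y (n + 1) ^ 2 ≤ A * B ^ n * Y n ^ q) → Tendsto Y atTop (𝓝 0) := by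
  have hq2 : 0 < q - 2 := by linarith
  -- The decay rate b < 1 is chosen so that B b^(q-2) ≤ 1, and ε below so that A ε^(q-2) = b². Then
  -- Yₙ ≤ ε bⁿ propagates by induction.
  set b : ℝ := min ((1 / B) ^ (1 / (q - 2))) (1 / 2) with hb
  have hb0 : 0 < b := lt_min (by positivity) (by norm_num)
  have hb1 : b < 1 := (min_le_right _ _).trans_lt (by norm_num)
  have hbB : B * b ^ (q - 2) ≤ 1 := by
    have h : b ^ (q - 2) ≤ 1 / B := by
      refine (Real.rpow_le_rpow hb0.le (min_le_left _ _) hq2.le).trans (le_of_eq ?_)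
      rw [← Real.rpow_mul (by positivity), one_div_mul_cancel hq2.ne', Real.rpow_one]
    calc B * b ^ (q - 2) ≤ B * (1 / B) := mul_le_mul_of_nonneg_left h hB.le
      _ = 1 := by field_simp
  set ε : ℝ := (b ^ 2 / A) ^ (1 / (q - 2)) with hε
  have hε0 : 0 < ε := by positivity
  have hεA : A * ε ^ (q - 2) = b ^ 2 := by
    rw [hε, ← Real.rpow_mul (by positivity), one_div_mul_cancel hq2.ne', Real.rpow_one]
    field_simp
  have hsplit : ∀ x : ℝ, 0 < x → x ^ q = x ^ (q - 2) * x ^ 2 := fun x hx => by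
    rw [← Real.rpow_natCast x 2, ← Real.rpow_add hx]; norm_num
  refine ⟨ε, hε0, fun Y hY hY0 hrec => ?_⟩
  have hbound : ∀ n, Y n ≤ ε * b ^ n := by
    intro n
    induction n with
    | zero => simpa using hY0
    | succ n ih =>
      refine le_of_sq_le_sq ?_ (by positivity)
      have hx : 0 < ε * b ^ n := by positivity
      calc Y (n + 1) ^ 2 ≤ A * B ^ n * Y n ^ q := hrec n
        _ ≤ A * B ^ n * (ε * b ^ n) ^ q := by
          gcongr
          exact hY n
        _ = (A * ε ^ (q - 2)) * (B * b ^ (q - 2)) ^ n * (ε * b ^ n) ^ 2 := by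
          rw [hsplit _ hx, Real.mul_rpow hε0.le (by positivity), ← Real.rpow_natCast_mul hb0.le,
            mul_comm (n : ℝ), Real.rpow_mul_natCast hb0.le, mul_pow B]
          ring
        _ ≤ b ^ 2 * 1 * (ε * b ^ n) ^ 2 := by
          rw [hεA]
          gcongr
          exact pow_le_one₀ (by positivity) hbB
        _ = (ε * b ^ (n + 1)) ^ 2 := by ring
  refine squeeze_zero hY hbound ?_
  simpa using (tendsto_pow_atTop_nhds_zero_of_lt_one hb0.le hb1).const_mul ε

variable {α : Type*} [MeasurableSpace α] {μ : Measure α} {u : α → ℝ} {q : ℝ}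

lemma abs_posPart_sub_le {s k : ℝ} (hk : 0 ≤ k) : |max (s - k) 0| ≤ |s| := by
  rw [abs_of_nonneg (le_max_right _ _)]
  exact max_le ((sub_le_self s hk).trans (le_abs_self s)) (abs_nonneg s)

lemma memLp_posPart_sub (hu : MemLp u (ENNReal.ofReal q) μ) {k : ℝ} (hk : 0 ≤ k) :
    MemLp (fun x => max (u x - k) 0) (ENNReal.ofReal q) μ :=
  hu.mono ((by fun_prop : Continuous fun s : ℝ => max (s - k) 0).comp_aestronglyMeasurable hu.1)
    (ae_of_all _ fun _ => abs_posPart_sub_le hk)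

/-- Dominated convergence with majorant |u|^q. This supplies the small starting value of the
iteration. -/
lemma tendsto_eLpNorm_posPart_sub (hq : 0 < q) (hu : MemLp u (ENNReal.ofReal q) μ) :
    Tendsto (fun k : ℝ => eLpNorm (fun x => max (u x - k) 0) (ENNReal.ofReal q) μ)
      atTop (𝓝 0) := by
  have hlim : Tendsto (fun k : ℝ => ∫⁻ x, ‖max (u x - k) 0‖ₑ ^ q ∂μ) atTop
      (𝓝 (∫⁻ _, 0 ∂μ)) := by
    refine tendsto_lintegral_filter_of_dominated_convergence' (fun x => ‖u x‖ₑ ^ q) ?_ ?_ ?_ ?_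
    · filter_upwards [eventually_ge_atTop (0 : ℝ)] with k hk
      exact (memLp_posPart_sub hu hk).1.enorm.pow_const _
    · filter_upwards [eventually_ge_atTop (0 : ℝ)] with k hk
      refine ae_of_all _ fun x => ENNReal.rpow_le_rpow ?_ hq.le
      exact enorm_le_iff_norm_le.2 (abs_posPart_sub_le hk)
    · rw [← eLpNorm_ofReal_rpow u hq]
      exact ENNReal.rpow_ne_top_of_nonneg hq.le hu.2.ne
    · refine ae_of_all _ fun x => tendsto_const_nhds.congr' ?_
      filter_upwards [eventually_ge_atTop (u x)] with k hk
      rw [max_eq_right (by linarith)]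
      simp [hq]
  have h := hlim.ennrpow_const (1 / q)
  simp only [lintegral_zero] at h
  rw [ENNReal.zero_rpow_of_pos (by positivity)] at h
  refine h.congr fun k => ?_
  rw [← eLpNorm_ofReal_rpow _ hq, ← ENNReal.rpow_mul, mul_one_div_cancel hq.ne', ENNReal.rpow_one]

/-- De Giorgi's iteration at the critical growth: a scale-invariant estimate between superlevel
sets bounds `u` from above, the tails of `u` in `L^q` being eventually small. -/
lemma exists_ae_le_of_level_estimate {A : NNReal} (hq : 2 < q)
    (hu : MemLp u (ENNReal.ofReal q) μ)
    (hlev : ∀ h b k : ℝ, 0 ≤ h → h < b → 1 ≤ b → b < k →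
      eLpNorm (fun x => max (u x - k) 0) (ENNReal.ofReal q) μ ^ 2 ≤
        A * ENNReal.ofReal ((b / (b - h)) ^ (q - 1)) *
          eLpNorm (fun x => max (u x - h) 0) (ENNReal.ofReal q) μ ^ q) :
    ∃ K : ℝ, ∀ᵐ x ∂μ, u x ≤ K := by
  have hq0 : 0 < q := by linarith
  have hq1 : 0 ≤ q - 1 := by linarith
  set g : ℝ → ENNReal := fun k => eLpNorm (fun x => max (u x - k) 0) (ENNReal.ofReal q) μ with hg
  have hgtop : ∀ k, 0 ≤ k → g k ≠ ⊤ := fun k hk => (memLp_posPart_sub hu hk).2.ne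
  -- The threshold ε is fixed before k₀. The constants come from the ratio bound 8 · 2ⁿ proved
  -- below, and `A + 1` replaces `A` only to be positive.
  obtain ⟨ε, hε, hconv⟩ := exists_smallness_of_superlinear
    (A := (A + 1) * 8 ^ (q - 1)) (B := 2 ^ (q - 1)) (q := q) (by positivity) (by positivity) hq
  obtain ⟨k₀, hk₀, hsmall⟩ : ∃ k₀ : ℝ, 1 ≤ k₀ ∧ g k₀ ≤ ENNReal.ofReal ε := by
    have h := ((tendsto_eLpNorm_posPart_sub hq0 hu).eventually
      (ge_mem_nhds (ENNReal.ofReal_pos.2 hε))).and (eventually_ge_atTop (1 : ℝ))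
    obtain ⟨k₀, h1, h2⟩ := h.exists
    exact ⟨k₀, h2, h1⟩
  set κ : ℕ → ℝ := fun n => k₀ * (2 - (1 / 2) ^ n) with hκ
  have hp0 : ∀ n : ℕ, (0 : ℝ) < (1 / 2) ^ n := fun n => by positivity
  have hp1 : ∀ n : ℕ, ((1 : ℝ) / 2) ^ n ≤ 1 := fun n =>
    pow_le_one₀ (by norm_num) (by norm_num)
  have hκ0 : ∀ n, 1 ≤ κ n := fun n => by
    have := hp1 n
    simp only [hκ]; nlinarith
  have hκK : ∀ n, κ n ≤ 2 * k₀ := fun n => by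
    have := hp0 n
    simp only [hκ]; nlinarith
  have hstep : ∀ n, κ (n + 1) - κ n = k₀ * (1 / 2) ^ n / 2 := fun n => by
    simp only [hκ, pow_succ]; ring
  have hY := hconv (fun n => (g (κ n)).toReal) (fun n => ENNReal.toReal_nonneg)
    (by
      refine ENNReal.toReal_le_of_le_ofReal hε.le ?_
      simpa [hκ, show (2 : ℝ) - 1 = 1 by norm_num] using hsmall)
    (fun n => by
      have hn := hp0 n
      have hd : 0 < κ (n + 1) - κ n := by rw [hstep]; positivity
      -- The midpoint leaves room on both sides: below it to compare u with u - κₙ, above it for the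
      -- ramp to rise.
      set b := (κ n + κ (n + 1)) / 2 with hb
      have hbn : b - κ n = k₀ * (1 / 2) ^ n / 4 := by
        rw [show b - κ n = (κ (n + 1) - κ n) / 2 by rw [hb]; ring, hstep]; ring
      have h := hlev (κ n) b (κ (n + 1)) (zero_le_one.trans (hκ0 n)) (by linarith)
        (by linarith [hκ0 n]) (by linarith)
      have hr : (b / (b - κ n)) ^ (q - 1) ≤ 8 ^ (q - 1) * (2 ^ (q - 1)) ^ n := by
        -- Here b ≤ 2k₀ and b - κₙ = k₀ 2⁻ⁿ/4, so k₀ cancels.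
        have hr' : b / (b - κ n) ≤ 8 * 2 ^ n := by
          rw [hbn, div_le_iff₀ (by positivity)]
          have : (8 : ℝ) * 2 ^ n * (k₀ * (1 / 2) ^ n / 4) = 2 * k₀ * (2 * (1 / 2)) ^ n := by
            rw [mul_pow]; ring
          rw [this, mul_one_div_cancel two_ne_zero, one_pow, mul_one]
          linarith [hκK n, hκK (n + 1)]
        refine (Real.rpow_le_rpow (div_nonneg (by linarith [hκ0 n]) (by linarith)) hr'
          hq1).trans (le_of_eq ?_)
        rw [Real.mul_rpow (by norm_num) (by positivity), ← Real.rpow_natCast_mul (by norm_num),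
          mul_comm (n : ℝ), Real.rpow_mul_natCast (by norm_num)]
      have h' := ENNReal.toReal_mono (ENNReal.mul_ne_top (ENNReal.mul_ne_top (by simp) (by simp))
        (ENNReal.rpow_ne_top_of_nonneg hq0.le (hgtop _ (zero_le_one.trans (hκ0 n))))) h
      rw [ENNReal.toReal_pow, ENNReal.toReal_mul, ENNReal.toReal_mul, ← ENNReal.toReal_rpow,
        ENNReal.toReal_ofReal (Real.rpow_nonneg
          (div_nonneg (by linarith [hκ0 n]) (by linarith)) _), ENNReal.coe_toReal] at h'
      refine h'.trans ?_
      refine mul_le_mul_of_nonneg_right ?_ (by positivity)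
      rw [mul_assoc]
      refine mul_le_mul (by linarith) hr (Real.rpow_nonneg
          (div_nonneg (by linarith [hκ0 n]) (by linarith)) _) (by positivity))
  have hK0 : (0 : ℝ) ≤ 2 * k₀ := by linarith
  -- All levels κₙ lie below 2k₀ and g is nonincreasing.
  have hzero : (g (2 * k₀)).toReal ≤ 0 := by
    refine ge_of_tendsto' hY fun n => ?_
    refine ENNReal.toReal_mono (hgtop _ (zero_le_one.trans (hκ0 n))) (eLpNorm_mono fun x => ?_)
    rw [Real.norm_eq_abs, Real.norm_eq_abs, abs_of_nonneg (le_max_right _ _),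
      abs_of_nonneg (le_max_right _ _)]
    exact max_le_max (by linarith [hκK n]) le_rfl
  have hg0 : g (2 * k₀) = 0 := by
    rcases (ENNReal.toReal_eq_zero_iff _).1 (le_antisymm hzero ENNReal.toReal_nonneg) with h | h
    · exact h
    · exact absurd h (hgtop _ hK0)
  refine ⟨2 * k₀, ?_⟩
  rw [hg, eLpNorm_eq_zero_iff (memLp_posPart_sub hu hK0).1 (by simpa using hq0)] at hg0
  filter_upwards [hg0] with x hx
  have := le_max_left (u x - 2 * k₀) 0
  have hx' : max (u x - 2 * k₀) 0 = 0 := hx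
  linarith

end Iteration

/-! ### The level estimate and the conclusion. -/

section Main

variable {N : ℕ}

/-- A weak subsolution estimate: `u` is bounded above. -/
lemma exists_ae_le_of_weak_equation (hN : 3 ≤ N) {C : ℝ} (hC : 0 ≤ C)
    {u F : EuclideanSpace ℝ (Fin N) → ℝ}
    {G : EuclideanSpace ℝ (Fin N) → EuclideanSpace ℝ (Fin N)}
    {φ : ℕ → EuclideanSpace ℝ (Fin N) → ℝ}
    (hu : MemLp u (ENNReal.ofReal (sobolevStar N)) volume) (hG : MemLp G 2 volume)
    (hφ : ∀ n, IsTestFunction (φ n))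
    (hφG : Tendsto (fun n => eLpNorm (fun x => gradient (φ n) x - G x) 2 volume) atTop (𝓝 0))
    (hφu : Tendsto (fun n => eLpNorm (fun x => φ n x - u x)
      (ENNReal.ofReal (sobolevStar N)) volume) atTop (𝓝 0))
    (hw : ∀ φ : EuclideanSpace ℝ (Fin N) → ℝ, IsTestFunction φ →
      ∫ x, inner ℝ (G x) (gradient φ x) = ∫ x, F x * φ x)
    (hFm : AEStronglyMeasurable F volume)
    (hF : ∀ x, |F x| ≤ C * (1 + |u x| ^ (sobolevStar N - 1))) :
    ∃ K : ℝ, ∀ᵐ x, u x ≤ K := by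
  obtain ⟨S, hS⟩ := exists_sobolev_const hN
  have hq : 2 < sobolevStar N := by
    have : (3 : ℝ) ≤ N := by exact_mod_cast hN
    rw [sobolevStar, lt_div_iff₀ (by linarith)]; linarith
  set q := sobolevStar N
  have hq1 : 0 ≤ q - 1 := by linarith
  refine exists_ae_le_of_level_estimate (A := S ^ 2 * (2 * C).toNNReal) hq hu
    fun h b k hh hhb hb hbk => ?_
  obtain ⟨Ψ, hΨ, hΨk⟩ := exists_isSmoothRamp hbk
  have hr : 0 ≤ b / (b - h) := div_nonneg (by linarith) (by linarith)
  have h1 := eLpNorm_comp_ramp_sq_le hS (by linarith) hC hu hG hφ hφG hφu hw hFm hF hΨ hb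
  have h2 : eLpNorm (fun x => max (u x - k) 0) (ENNReal.ofReal q) volume ≤
      eLpNorm (fun x => Ψ (u x)) (ENNReal.ofReal q) volume := eLpNorm_mono fun x => by
    rw [Real.norm_eq_abs, Real.norm_eq_abs, abs_of_nonneg (le_max_right _ _),
      abs_of_nonneg (hΨ.nonneg _)]
    exact max_le (hΨk _) (hΨ.nonneg _)
  have h3 : ∀ x, ‖F x‖ₑ * ‖Ψ (u x)‖ₑ ≤
      ENNReal.ofReal (2 * C * (b / (b - h)) ^ (q - 1)) * ‖max (u x - h) 0‖ₑ ^ q := fun x => by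
    have key : |F x| * |Ψ (u x)| ≤
        2 * C * (b / (b - h)) ^ (q - 1) * |max (u x - h) 0| ^ q := by
      rcases le_or_gt (u x) b with hub | hub
      · rw [hΨ.eq_zero _ hub, abs_zero, mul_zero]; positivity
      · have hd : 0 < u x - h := by linarith
        have hu0 : 0 ≤ u x := by linarith
        have hΨle : Ψ (u x) ≤ u x - h :=
          (hΨ.le_posPart _).trans (max_le (by linarith) hd.le)
        have hone : 1 ≤ u x ^ (q - 1) := Real.one_le_rpow (by linarith) hq1
        -- After clearing denominators this is h b ≤ h u, true since h ≥ 0 and u > b.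
        have hule : u x ≤ b / (b - h) * (u x - h) := by
          rw [div_mul_eq_mul_div, le_div_iff₀ (by linarith)]
          nlinarith
        have hFle : |F x| ≤ 2 * C * ((b / (b - h)) ^ (q - 1) * (u x - h) ^ (q - 1)) := by
          have hFx := hF x
          rw [abs_of_nonneg hu0] at hFx
          rw [← Real.mul_rpow hr hd.le]
          have := Real.rpow_le_rpow hu0 hule hq1
          calc |F x| ≤ C * (1 + u x ^ (q - 1)) := hFx
            _ ≤ C * (2 * (b / (b - h) * (u x - h)) ^ (q - 1)) :=
              mul_le_mul_of_nonneg_left (by linarith) hC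
            _ = _ := by ring
        rw [abs_of_nonneg (hΨ.nonneg _), max_eq_left hd.le, abs_of_pos hd]
        calc |F x| * Ψ (u x)
            ≤ 2 * C * ((b / (b - h)) ^ (q - 1) * (u x - h) ^ (q - 1)) * (u x - h) :=
              mul_le_mul hFle hΨle (hΨ.nonneg _) (by positivity)
          _ = 2 * C * (b / (b - h)) ^ (q - 1) * ((u x - h) ^ (q - 1) * (u x - h)) := by ring
          _ = _ := by rw [← Real.rpow_add_one hd.ne', sub_add_cancel]
    have hk := ENNReal.ofReal_le_ofReal key
    rw [ENNReal.ofReal_mul (abs_nonneg _), ENNReal.ofReal_mul (by positivity),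
      ← ENNReal.ofReal_rpow_of_nonneg (abs_nonneg _) (by linarith)] at hk
    simpa only [← Real.enorm_eq_ofReal_abs] using hk
  calc _ ≤ _ := pow_le_pow_left' h2 2
    _ ≤ _ := h1
    _ ≤ (S : ENNReal) ^ 2 * (ENNReal.ofReal (2 * C * (b / (b - h)) ^ (q - 1)) *
          eLpNorm (fun x => max (u x - h) 0) (ENNReal.ofReal q) volume ^ q) := by
      refine mul_le_mul_right ((lintegral_mono h3).trans (le_of_eq ?_)) _
      rw [lintegral_const_mul' _ _ ENNReal.ofReal_ne_top, eLpNorm_ofReal_rpow _ (by linarith)]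
    _ = _ := by
      rw [ENNReal.ofReal_mul (by positivity)]
      push_cast
      simp only [ENNReal.ofReal]
      ring

end Main

theorem mainTheorem10 (N : ℕ) (hN : 3 ≤ N)
    (f : EuclideanSpace ℝ (Fin N) → ℝ → ℝ) (p C₀ : ℝ)
    (hp : 2 ≤ p) (hp' : p ≤ sobolevStar N) (hC₀ : 0 < C₀)
    (hf : ∀ (x : EuclideanSpace ℝ (Fin N)) (s : ℝ),
      |f x s| ≤ C₀ * (|s| ^ (p - 1) + |s| ^ (sobolevStar N - 1)))
    (u : EuclideanSpace ℝ (Fin N) → ℝ)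
    (huD : MemD12 u) (huL : MemLp u (ENNReal.ofReal p) volume)
    (hu : IsWeakSolution f u) :
    MemLp u ⊤ volume := by
  obtain ⟨huq, G, hGw, hG, φ, hφ, hφG, hφu⟩ := huD
  obtain ⟨hFl, G', hGw', hw'⟩ := hu
  -- The gradient in the equation and the one approximated in L² agree by uniqueness of weak
  -- gradients.
  have hGG : ∀ᵐ x, G' x = G x :=
    ae_eq_of_integral_contDiff_smul_eq hGw'.2.1 hGw.2.1 fun ψ h1 h2 =>
      neg_injective ((hGw'.2.2 ψ ⟨h1, h2⟩).symm.trans (hGw.2.2 ψ ⟨h1, h2⟩))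
  have hw : ∀ φ : EuclideanSpace ℝ (Fin N) → ℝ, IsTestFunction φ →
      ∫ x, inner ℝ (G x) (gradient φ x) = ∫ x, f x (u x) * φ x := fun ψ hψ => by
    rw [← hw' ψ hψ]
    refine integral_congr_ae ?_
    filter_upwards [hGG] with x hx
    rw [hx]
  have hF : ∀ x, |f x (u x)| ≤ 2 * C₀ * (1 + |u x| ^ (sobolevStar N - 1)) := fun x => by
    refine (hf x (u x)).trans ?_
    have h0 : 0 ≤ |u x| ^ (sobolevStar N - 1) := by positivity
    have h1 : |u x| ^ (p - 1) ≤ 1 + |u x| ^ (sobolevStar N - 1) := by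
      rcases le_total |u x| 1 with h | h
      · linarith [Real.rpow_le_one (abs_nonneg (u x)) h (by linarith : 0 ≤ p - 1)]
      · linarith [Real.rpow_le_rpow_of_exponent_le h
          (by linarith : p - 1 ≤ sobolevStar N - 1)]
    nlinarith
  obtain ⟨K₁, hK₁⟩ := exists_ae_le_of_weak_equation hN (by positivity) huq hG hφ hφG hφu hw
    hFl.aestronglyMeasurable hF
  have hgneg : ∀ n x, gradient (fun y => -φ n y) x = -gradient (φ n) x := fun n x => by
    simp [gradient, fderiv_fun_neg]
  -- The function -u solves the equation with right-hand side -f(x,u), which obeys the same bound.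
  obtain ⟨K₂, hK₂⟩ := exists_ae_le_of_weak_equation (u := fun x => -u x) (G := fun x => -G x)
    (φ := fun n x => -φ n x) (F := fun x => -f x (u x)) (C := 2 * C₀) hN (by positivity) huq.neg hG.neg
    (fun n => ⟨(hφ n).1.neg, (hφ n).2.neg⟩)
    (hφG.congr fun n => by
      rw [← eLpNorm_neg]
      congr 1
      funext x
      simp only [Pi.neg_apply, hgneg]
      abel)
    (hφu.congr fun n => by
      rw [← eLpNorm_neg]
      congr 1
      funext x
      simp only [Pi.neg_apply]
      ring)
    (fun ψ hψ => by simp only [inner_neg_left, neg_mul, integral_neg, hw ψ hψ])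
    hFl.aestronglyMeasurable.neg (fun x => by simpa only [abs_neg] using hF x)
  refine memLp_top_of_bound huq.1 (max K₁ K₂) ?_
  filter_upwards [hK₁, hK₂] with x h1 h2
  rw [Real.norm_eq_abs, abs_le]
  have := le_max_left K₁ K₂
  have := le_max_right K₁ K₂
  constructor <;> linarith
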